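/- Let $X$ be a complex Banach space and let $T\in\mathcal B(X)$ be supercyclic, i.e. there is $x\in X$ such that $\{\lambda T^n x : \lambda\in\mathbb C,\ n=0,1,2,\dots\}$ is dense in $X$. Then $$\sigma_{rgD}(T)=\sigma_{pBlF}(T).$$ Here, for $S\in\mathcal B(X)$: - The quasi-nilpotent part of $S$ is $H_0(S)=\{x\in X:\lim_{n\to\infty}\|S^nx\|^{1/n}=0\}$. The analytic core $K(S)$ is the set of all $x\in X$ for which there are $c>0$ and a sequence $(u_n)_{n\ge 0}$ in $X$ with $u_0=x$, $Su_{n+1}=u_n$ and $\|u_n\|\le c^n\|x\|$ for all $n\ge 0$. - $S$ is right generalized Drazin invertible if $K(S)$ is closed and there is a closed $S$-invariant subspace $N\subseteq H_0(S)$ with $X=K(S)\oplus N$. The right generalized Drazin spectrum is $\sigma_{rgD}(T)=\{\lambda\in\mathbb C: T-\lambda I \text{ is not right generalized Drazin invertible}\}$. - $S$ is pseudo lower semi B-Fredholm if there are closed $S$-invariant subspaces $X_1,X_2$ with $X=X_1\oplus X_2$ such that $S|_{X_1}$ is lower semi-Fredholm (its range has finite codimension in $X_1$) and $S|_{X_2}$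 is quasi-nilpotent (its spectral radius is $0$). The pseudo lower semi B-Fredholm spectrum is $\sigma_{pBlF}(T)=\{\lambda\in\mathbb C: T-\lambda I \text{ is not pseudo lower semi B-Fredholm}\}$. -/

import Mathlib

open Filter Topology

namespace SupercyclicOp

variable {E : Type*} [NormedAddCommGroup E] [NormedSpace ℂ E]

/-- `T` is supercyclic: for some vector `x`, the set of all scalar multiples of the iterates
`T ^ n x` (`n = 0, 1, 2, …`) is dense. -/
def IsSupercyclic (T : E →L[ℂ] E) : Prop :=
  ∃ x : E, Dense {y : E | ∃ (c : ℂ) (n : ℕ), y = c • (T ^ n) x}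

/-- The quasi-nilpotent part `H₀(T) = {x | lim ‖T ^ n x‖ ^ (1 / n) = 0}`. -/
def quasinilpotentPart (T : E →L[ℂ] E) : Set E :=
  {x : E | Tendsto (fun n : ℕ => ‖(T ^ n) x‖ ^ ((1 : ℝ) / (n : ℝ))) atTop (𝓝 0)}

/-- The analytic core `K(T)`: the vectors `x` that have a backward orbit `x = u 0`,
`T (u (n + 1)) = u n`, of at most geometric growth `‖u n‖ ≤ c ^ n * ‖x‖`. -/
def analyticCore (T : E →L[ℂ] E) : Set E :=
  {x : E | ∃ (u : ℕ → E) (c : ℝ), 0 < c ∧ u 0 = x ∧ (∀ n : ℕ, T (u (n + 1)) = u n) ∧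
    ∀ n : ℕ, ‖u n‖ ≤ c ^ n * ‖x‖}

/-- `T` is quasi-nilpotent: its spectral radius is `0`. -/
def IsQuasinilpotent (T : E →L[ℂ] E) : Prop :=
  spectralRadius ℂ T = 0

/-- `T` is lower semi-Fredholm: its range has finite codimension. -/
def IsLowerSemiFredholm (T : E →L[ℂ] E) : Prop :=
  FiniteDimensional ℂ (E ⧸ T.range)

/-- `E = M ⊕ N` with `M`, `N` closed and `T`-invariant, so that `T = T|M ⊕ T|N`. -/
structure IsReducingPair (T : E →L[ℂ] E) (M N : Submodule ℂ E) : Prop where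
  isCompl : IsCompl M N
  isClosed_left : IsClosed (M : Set E)
  isClosed_right : IsClosed (N : Set E)
  invariant_left : ∀ x ∈ M, T x ∈ M
  invariant_right : ∀ x ∈ N, T x ∈ N

/-- `T` is pseudo lower semi B-Fredholm: `T = T|M ⊕ T|N` with `T|M` lower semi-Fredholm and
`T|N` quasi-nilpotent. -/
def IsPseudoLowerSemiBFredholm (T : E →L[ℂ] E) : Prop :=
  ∃ (M N : Submodule ℂ E) (h : IsReducingPair T M N),
    IsLowerSemiFredholm (T.restrict h.invariant_left) ∧
      IsQuasinilpotent (T.restrict h.invariant_right)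

/-- `T` is right generalized Drazin invertible: the analytic core `K(T)` is a closed subspace
that has a closed `T`-invariant complement `N` contained in the quasi-nilpotent part `H₀(T)`. -/
def IsRightGeneralizedDrazin (T : E →L[ℂ] E) : Prop :=
  ∃ M N : Submodule ℂ E, (M : Set E) = analyticCore T ∧ IsReducingPair T M N ∧
    (N : Set E) ⊆ quasinilpotentPart T

/-- The right generalized Drazin spectrum `σ_rgD(T)`. -/
def rightGeneralizedDrazinSpectrum (T : E →L[ℂ] E) : Set ℂ :=
  {z : ℂ | ¬ IsRightGeneralizedDrazin (T - z • (1 : E →L[ℂ] E))}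

/-- The pseudo lower semi B-Fredholm spectrum `σ_pBlF(T)`. -/
def pseudoLowerSemiBFredholmSpectrum (T : E →L[ℂ] E) : Set ℂ :=
  {z : ℂ | ¬ IsPseudoLowerSemiBFredholm (T - z • (1 : E →L[ℂ] E))}

end SupercyclicOp

namespace SupercyclicOp

/-! Both properties of `A = T - z` ask for a reducing pair `M`, `N` with `A` quasi-nilpotent on `N`;
on `M` one asks for surjectivity (`isRightGeneralizedDrazin_iff`), the other only for finite
codimension of the range. So one inclusion is immediate.

For the other, let `B` be `A` on `M`. Supercyclicity descends to `B + z`, and since this operator is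
scalar modulo the closed range of `B`, that range has codimension at most one. If it has codimension
one, `ker B` is not inside it: otherwise a functional `f` killing the range factors as `g ∘ B`, and
the ratios `g / f` along the orbit form the discrete set `g x / f x + n / z` (for `z = 0`, `f` dies
after one step), which contradicts density (`not_isSupercyclic_of_jordan_chain`). Hence `M = ran B ⊕
span w` with `B w = 0`, and moving `w` into `N` leaves a surjective part. -/

/-! ### Sequences that decay faster than every geometric sequence -/

/-- `a ^ (1 / n) → 0` exactly when `a` is dominated by every geometric sequence. -/
theorem tendsto_root_zero_iff {a : ℕ → ℝ} (ha : ∀ n, 0 ≤ a n) :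
    Tendsto (fun n : ℕ => a n ^ ((1 : ℝ) / (n : ℝ))) atTop (𝓝 0) ↔
      ∀ ε : ℝ, 0 < ε → ∃ C : ℝ, ∀ n, a n ≤ C * ε ^ n := by
  have key : ∀ {n : ℕ} {r : ℝ}, n ≠ 0 → 0 ≤ r → a n ^ ((1 : ℝ) / (n : ℝ)) ≤ r → a n ≤ r ^ n := by
    intro n r hn hr h
    have h2 := pow_le_pow_left₀ (Real.rpow_nonneg (ha n) _) h n
    rwa [one_div, Real.rpow_inv_natCast_pow (ha n) hn] at h2
  constructor
  · intro h ε hε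
    have h1 : ∀ᶠ n : ℕ in atTop, a n / ε ^ n ≤ 1 := by
      filter_upwards [h.eventually (gt_mem_nhds hε), eventually_ne_atTop 0] with n hn h0
      exact (div_le_one (by positivity)).2 (key h0 hε.le hn.le)
    obtain ⟨C, hC⟩ := (isBoundedUnder_of_eventually_le h1).bddAbove_range
    exact ⟨C, fun n => (div_le_iff₀ (by positivity)).1 (hC ⟨n, rfl⟩)⟩
  · intro h
    rw [Metric.tendsto_atTop']
    intro ε hε
    -- Once `2 ^ n` exceeds `C`, the constant costs a factor 2 in the base; `ε / 2` then leaves the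
    -- strict inequality.
    obtain ⟨C, hC⟩ := h (ε / 4) (by positivity)
    obtain ⟨N, hN⟩ := pow_unbounded_of_one_lt C (one_lt_two)
    refine ⟨N, fun n hn => ?_⟩
    have hn0 : n ≠ 0 := by lia
    have h1 : a n ≤ (ε / 2) ^ n := by
      calc a n ≤ C * (ε / 4) ^ n := hC n
        _ ≤ 2 ^ n * (ε / 4) ^ n := by
            gcongr
            exact hN.le.trans (pow_le_pow_right₀ one_le_two hn.le)
        _ = (ε / 2) ^ n := by rw [← mul_pow]; congr 1; ring
    have h2 : a n ^ ((1 : ℝ) / (n : ℝ)) ≤ ε / 2 := by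
      calc a n ^ ((1 : ℝ) / (n : ℝ)) ≤ ((ε / 2) ^ n) ^ ((1 : ℝ) / (n : ℝ)) := by
            gcongr
            exact ha n
        _ = ε / 2 := by rw [one_div, Real.pow_rpow_inv_natCast (by positivity) hn0]
    rw [Real.dist_eq, sub_zero, abs_of_nonneg (Real.rpow_nonneg (ha n) _)]
    linarith

section

variable {E : Type*} [NormedAddCommGroup E] [NormedSpace ℂ E]

theorem mem_quasinilpotentPart_iff {T : E →L[ℂ] E} {x : E} :
    x ∈ quasinilpotentPart T ↔ ∀ ε : ℝ, 0 < ε → ∃ C : ℝ, ∀ n, ‖(T ^ n) x‖ ≤ C * ε ^ n :=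
  tendsto_root_zero_iff fun _ => norm_nonneg _

/-- A quasi-nilpotent operator on a Banach space has powers of superexponential decay. -/
theorem IsQuasinilpotent.exists_norm_pow_le [CompleteSpace E] {T : E →L[ℂ] E}
    (h : IsQuasinilpotent T) {ε : ℝ} (hε : 0 < ε) : ∃ C : ℝ, ∀ n, ‖T ^ n‖ ≤ C * ε ^ n := by
  refine (tendsto_root_zero_iff fun n => norm_nonneg (T ^ n)).1 ?_ ε hε
  have h1 := spectrum.pow_norm_pow_one_div_tendsto_nhds_spectralRadius T
  rw [show spectralRadius ℂ T = 0 from h] at h1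
  have h2 := (ENNReal.tendsto_toReal ENNReal.zero_ne_top).comp h1
  refine h2.congr fun n => ?_
  simp only [Function.comp_apply]
  exact ENNReal.toReal_ofReal (Real.rpow_nonneg (norm_nonneg _) _)

/-- Superexponential decay of the powers forces the spectral radius to vanish. -/
theorem isQuasinilpotent_of_norm_pow_le [CompleteSpace E] {T : E →L[ℂ] E}
    (h : ∀ ε : ℝ, 0 < ε → ∃ C : ℝ, ∀ n, ‖T ^ n‖ ≤ C * ε ^ n) : IsQuasinilpotent T := by
  have h0 : ∀ k ∈ spectrum ℂ T, k = 0 := by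
    intro k hk
    by_contra hk0
    have hpos : 0 < ‖k‖ := norm_pos_iff.2 hk0
    -- As `k ^ n` is in the spectrum of `T ^ n`, this rate would give `2 ^ n ≤ C` for every `n`.
    obtain ⟨C, hC⟩ := h (‖k‖ / 2) (by positivity)
    obtain ⟨n, hn⟩ := pow_unbounded_of_one_lt C (one_lt_two)
    have h1 := spectrum.norm_le_norm_mul_of_mem (spectrum.pow_mem_pow T n hk)
    have h2 : ‖k‖ ^ n ≤ C * (‖k‖ / 2) ^ n := by
      rw [← norm_pow]
      calc ‖k ^ n‖ ≤ ‖T ^ n‖ * ‖(1 : E →L[ℂ] E)‖ := h1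
        _ ≤ ‖T ^ n‖ * 1 := by
            gcongr
            exact ContinuousLinearMap.norm_id_le
        _ ≤ _ := by rw [mul_one]; exact hC n
    rw [div_pow, ← mul_div_assoc, le_div_iff₀ (by positivity)] at h2
    nlinarith [pow_pos hpos n]
  refine le_antisymm (iSup₂_le fun k hk => ?_) bot_le
  simp [h0 k hk]

/-- On a Banach space, an operator that is locally quasi-nilpotent is quasi-nilpotent. -/
theorem isQuasinilpotent_of_forall_mem_quasinilpotentPart [CompleteSpace E] {T : E →L[ℂ] E}
    (h : ∀ x, x ∈ quasinilpotentPart T) : IsQuasinilpotent T := by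
  refine isQuasinilpotent_of_norm_pow_le fun ε hε => ?_
  -- Uniform boundedness for `ε⁻ⁿ Tⁿ` turns the pointwise constants into one.
  obtain ⟨C, hC⟩ := banach_steinhaus (g := fun n : ℕ => ((ε ^ n)⁻¹ : ℂ) • T ^ n) fun x => by
    obtain ⟨C, hC⟩ := mem_quasinilpotentPart_iff.1 (h x) ε hε
    refine ⟨C, fun n => ?_⟩
    have h1 : ‖((ε : ℂ) ^ n)⁻¹‖ = (ε ^ n)⁻¹ := by
      rw [norm_inv, norm_pow, Complex.norm_real, Real.norm_of_nonneg hε.le]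
    rw [smul_apply, norm_smul, h1, inv_mul_le_iff₀ (by positivity), mul_comm]
    exact hC n
  refine ⟨C, fun n => ?_⟩
  have h1 : ‖((ε : ℂ) ^ n)⁻¹‖ = (ε ^ n)⁻¹ := by
    rw [norm_inv, norm_pow, Complex.norm_real, Real.norm_of_nonneg hε.le]
  have h2 := hC n
  rwa [norm_smul, h1, inv_mul_le_iff₀ (by positivity), mul_comm] at h2

theorem coe_restrict_pow_apply {T : E →L[ℂ] E} {M : Submodule ℂ E} (h : ∀ x ∈ M, T x ∈ M)
    (n : ℕ) (x : M) : (((T.restrict h) ^ n) x : E) = (T ^ n) x := by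
  induction n generalizing x with
  | zero => simp
  | succ n ih =>
    rw [pow_succ, pow_succ, mul_apply_eq_comp, mul_apply_eq_comp, ih,
      ContinuousLinearMap.coe_restrict_apply]

theorem mem_quasinilpotentPart_restrict_iff {T : E →L[ℂ] E} {M : Submodule ℂ E}
    (h : ∀ x ∈ M, T x ∈ M) (x : M) :
    x ∈ quasinilpotentPart (T.restrict h) ↔ (x : E) ∈ quasinilpotentPart T := by
  simp only [mem_quasinilpotentPart_iff, ← coe_restrict_pow_apply h, Submodule.coe_norm]

theorem IsQuasinilpotent.mem_quasinilpotentPart [CompleteSpace E] {T : E →L[ℂ] E}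
    (h : IsQuasinilpotent T) (x : E) : x ∈ quasinilpotentPart T := by
  refine mem_quasinilpotentPart_iff.2 fun ε hε => ?_
  obtain ⟨C, hC⟩ := h.exists_norm_pow_le hε
  refine ⟨C * ‖x‖, fun n => ((T ^ n).le_opNorm x).trans ?_⟩
  nlinarith [hC n, norm_nonneg x]

/-- A closed invariant subspace lies in the quasi-nilpotent part exactly when the restriction
to it is quasi-nilpotent. -/
theorem isQuasinilpotent_restrict_iff [CompleteSpace E] {T : E →L[ℂ] E} {N : Submodule ℂ E}
    (hN : IsClosed (N : Set E)) (h : ∀ x ∈ N, T x ∈ N) :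
    IsQuasinilpotent (T.restrict h) ↔ (N : Set E) ⊆ quasinilpotentPart T := by
  have := hN.completeSpace_coe
  constructor
  · intro hq x hx
    exact (mem_quasinilpotentPart_restrict_iff h ⟨x, hx⟩).1 (hq.mem_quasinilpotentPart _)
  · intro hs
    exact isQuasinilpotent_of_forall_mem_quasinilpotentPart fun x =>
      (mem_quasinilpotentPart_restrict_iff h x).2 (hs x.2)

/-! ### The analytic core -/

/-- `T` maps the analytic core onto itself. -/
theorem exists_mem_analyticCore_map_eq {T : E →L[ℂ] E} {x : E} (hx : x ∈ analyticCore T) :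
    ∃ y ∈ analyticCore T, T y = x := by
  obtain ⟨u, c, hc, h0, hu, hb⟩ := hx
  -- The bound must be in terms of `‖u 1‖`, not `‖x‖`. The extra factor `c * ‖T‖` is absorbed into
  -- the base, which works from index 1 on; index 0 is trivial.
  refine ⟨u 1, ⟨fun n => u (n + 1), c * max 1 (c * ‖T‖), by positivity, rfl,
    fun n => hu (n + 1), fun n => ?_⟩, by rw [← h0]; exact hu 0⟩
  rcases n with _ | n
  · simp
  have h1 : ‖x‖ ≤ ‖T‖ * ‖u 1‖ := by
    rw [← h0, ← hu 0]
    exact T.le_opNorm _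
  have h2 : c * ‖T‖ ≤ max 1 (c * ‖T‖) ^ (n + 1) :=
    (le_max_right _ _).trans (le_self_pow₀ (le_max_left _ _) (by simp))
  calc ‖u (n + 1 + 1)‖ ≤ c ^ (n + 1 + 1) * ‖x‖ := hb _
    _ ≤ c ^ (n + 1 + 1) * (‖T‖ * ‖u 1‖) := by gcongr
    _ = c ^ (n + 1) * (c * ‖T‖) * ‖u 1‖ := by ring
    _ ≤ c ^ (n + 1) * max 1 (c * ‖T‖) ^ (n + 1) * ‖u 1‖ := by gcongr
    _ = _ := by rw [mul_pow]

/-- A closed subspace that `T` maps onto itself lies in the analytic core. -/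
theorem subset_analyticCore [CompleteSpace E] {T : E →L[ℂ] E} {M : Submodule ℂ E}
    (hM : IsClosed (M : Set E)) (h : ∀ x ∈ M, T x ∈ M) (hs : ∀ x ∈ M, ∃ y ∈ M, T y = x) :
    (M : Set E) ⊆ analyticCore T := by
  have := hM.completeSpace_coe
  have hsurj : Function.Surjective (T.restrict h) := fun x => by
    obtain ⟨y, hy, hyx⟩ := hs x x.2
    exact ⟨⟨y, hy⟩, Subtype.ext hyx⟩
  -- The open mapping theorem bounds preimages linearly; iterating a choice of them gives the
  -- backward orbit.
  obtain ⟨C, hC, hpre⟩ := (T.restrict h).exists_preimage_norm_le hsurj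
  choose r hr hrC using hpre
  intro x hx
  refine ⟨fun n => (r^[n] ⟨x, hx⟩ : M), C, hC, rfl, fun n => ?_, fun n => ?_⟩
  · simp only [Function.iterate_succ_apply']
    rw [← ContinuousLinearMap.coe_restrict_apply h, hr]
  · induction n with
    | zero => simp
    | succ n ih =>
      simp only [Function.iterate_succ_apply', pow_succ']
      refine (hrC _).trans ?_
      rw [mul_assoc]
      gcongr
      exact ih

theorem IsReducingPair.symm {T : E →L[ℂ] E} {M N : Submodule ℂ E} (h : IsReducingPair T M N) :
    IsReducingPair T N M :=
  ⟨h.isCompl.symm, h.isClosed_right, h.isClosed_left, h.invariant_right, h.invariant_left⟩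

theorem IsReducingPair.isTopCompl [CompleteSpace E] {T : E →L[ℂ] E} {M N : Submodule ℂ E}
    (h : IsReducingPair T M N) : Submodule.IsTopCompl M N :=
  Submodule.IsCompl.isTopCompl_of_isClosed h.isCompl h.isClosed_left h.isClosed_right

/-- The projection onto a summand of a reducing pair intertwines `T` with its restriction. -/
theorem IsReducingPair.projectionOntoL_apply [CompleteSpace E] {T : E →L[ℂ] E}
    {M N : Submodule ℂ E} (h : IsReducingPair T M N) (x : E) :
    M.projectionOntoL N h.isTopCompl (T x) =
      T.restrict h.invariant_left (M.projectionOntoL N h.isTopCompl x) := by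
  set P := M.projectionOntoL N h.isTopCompl
  obtain ⟨a, ha, b, hb, rfl⟩ := Submodule.mem_sup.1
    (h.isCompl.sup_eq_top ▸ Submodule.mem_top : x ∈ M ⊔ N)
  have h1 : ∀ y ∈ N, P y = 0 := fun y hy => (Submodule.projectionOntoL_apply_eq_zero_iff _).2 hy
  have h2 : ∀ y (hy : y ∈ M), P y = ⟨y, hy⟩ := fun y hy =>
    Submodule.projectionOntoL_apply_left h.isTopCompl ⟨y, hy⟩
  rw [map_add, map_add, map_add, h1 b hb, h1 _ (h.invariant_right b hb), h2 a ha,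
    h2 _ (h.invariant_left a ha), add_zero, add_zero]
  rfl

/-- In a decomposition with surjective first part and quasi-nilpotent second part, the first
summand is the analytic core. -/
theorem IsReducingPair.eq_analyticCore [CompleteSpace E] {T : E →L[ℂ] E} {M N : Submodule ℂ E}
    (h : IsReducingPair T M N) (hs : ∀ x ∈ M, ∃ y ∈ M, T y = x)
    (hN : (N : Set E) ⊆ quasinilpotentPart T) : (M : Set E) = analyticCore T := by
  refine (subset_analyticCore h.isClosed_left h.invariant_left hs).antisymm ?_
  rintro x ⟨u, c, hc, h0, hu, hb⟩
  have := h.isClosed_right.completeSpace_coe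
  set P := N.projectionOntoL M h.symm.isTopCompl
  set A := T.restrict h.invariant_right
  have hq : IsQuasinilpotent A := (isQuasinilpotent_restrict_iff h.isClosed_right _).2 hN
  have hPT : ∀ y, P (T y) = A (P y) := h.symm.projectionOntoL_apply
  have hPu : ∀ n, P x = (A ^ n) (P (u n)) := by
    intro n
    induction n with
    | zero => simp [h0]
    | succ n ih =>
      rw [ih, ← hu n, hPT, pow_succ, mul_apply_eq_comp]
  -- The rate `1 / (2c)` beats the growth `c ^ n` of the backward orbit, forcing `P x = 0`.
  obtain ⟨C, hC⟩ := hq.exists_norm_pow_le (ε := (2 * c)⁻¹) (by positivity)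
  have hle : ∀ n : ℕ, ‖P x‖ ≤ (C * (‖P‖ * ‖x‖)) * (1 / 2) ^ n := by
    intro n
    have hC0 := (norm_nonneg _).trans (hC n)
    calc ‖P x‖ = ‖(A ^ n) (P (u n))‖ := by rw [← hPu n]
      _ ≤ ‖A ^ n‖ * (‖P‖ * ‖u n‖) := (A ^ n).le_opNorm_of_le (P.le_opNorm _)
      _ ≤ (C * (2 * c)⁻¹ ^ n) * (‖P‖ * (c ^ n * ‖x‖)) := by
          gcongr
          · exact hC n
          · exact hb n
      _ = (C * (‖P‖ * ‖x‖)) * ((2 * c)⁻¹ * c) ^ n := by rw [mul_pow]; ring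
      _ = _ := by congr 2; field_simp
  have hlim : Tendsto (fun n : ℕ => (C * (‖P‖ * ‖x‖)) * (1 / 2 : ℝ) ^ n) atTop (𝓝 0) := by
    simpa using (tendsto_pow_atTop_nhds_zero_of_lt_one (r := (1 / 2 : ℝ)) (by norm_num)
      (by norm_num)).const_mul (C * (‖P‖ * ‖x‖))
  have hPx : P x = 0 := norm_le_zero_iff.1 (ge_of_tendsto' hlim hle)
  exact (Submodule.projectionOntoL_apply_eq_zero_iff _).1 hPx

/-- Right generalized Drazin invertibility as a decomposition into a surjective and a
quasi-nilpotent part. -/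
theorem isRightGeneralizedDrazin_iff [CompleteSpace E] {T : E →L[ℂ] E} :
    IsRightGeneralizedDrazin T ↔ ∃ M N : Submodule ℂ E, IsReducingPair T M N ∧
      (∀ x ∈ M, ∃ y ∈ M, T y = x) ∧ (N : Set E) ⊆ quasinilpotentPart T := by
  constructor
  · rintro ⟨M, N, hM, h, hN⟩
    refine ⟨M, N, h, fun x hx => ?_, hN⟩
    obtain ⟨y, hy, hyx⟩ := exists_mem_analyticCore_map_eq (hM ▸ hx : x ∈ analyticCore T)
    exact ⟨y, (hM ▸ hy : y ∈ (M : Set E)), hyx⟩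
  · rintro ⟨M, N, h, hs, hN⟩
    exact ⟨M, N, h.eq_analyticCore hs hN, h, hN⟩

/-- The same decomposition serves: a surjective part has range of codimension zero. -/
theorem IsRightGeneralizedDrazin.isPseudoLowerSemiBFredholm [CompleteSpace E] {T : E →L[ℂ] E}
    (hT : IsRightGeneralizedDrazin T) : IsPseudoLowerSemiBFredholm T := by
  obtain ⟨M, N, h, hs, hN⟩ := isRightGeneralizedDrazin_iff.1 hT
  refine ⟨M, N, h, ?_, (isQuasinilpotent_restrict_iff h.isClosed_right _).2 hN⟩
  have hr : (T.restrict h.invariant_left).range = ⊤ := LinearMap.range_eq_top.2 fun x => by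
    obtain ⟨y, hy, hyx⟩ := hs x x.2
    exact ⟨⟨y, hy⟩, Subtype.ext hyx⟩
  rw [IsLowerSemiFredholm, hr]
  infer_instance

/-! ### Lower semi-Fredholm shifts of supercyclic operators -/

/-- An operator on a Banach space whose range has finite codimension has closed range. -/
theorem IsLowerSemiFredholm.isClosed_range [CompleteSpace E] {T : E →L[ℂ] E}
    (h : IsLowerSemiFredholm T) : IsClosed (T.range : Set E) := by
  have : FiniteDimensional ℂ (E ⧸ T.range) := h
  obtain ⟨G, hG⟩ := T.range.exists_isCompl
  have hfin : FiniteDimensional ℂ G :=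
    LinearEquiv.finiteDimensional (Submodule.quotientEquivOfIsCompl _ _ hG)
  -- By the open mapping theorem `F` is a quotient map, so closedness can be tested on the preimage.
  set F : E × G →L[ℂ] E := T.coprod G.subtypeL
  have hF : Function.Surjective F := by
    intro y
    obtain ⟨_, ⟨a, rfl⟩, b, hb, rfl⟩ := Submodule.mem_sup.1
      (hG.sup_eq_top ▸ Submodule.mem_top : y ∈ T.range ⊔ G)
    exact ⟨(a, ⟨b, hb⟩), rfl⟩
  have : CompleteSpace G := FiniteDimensional.complete ℂ G
  rw [← (F.isQuotientMap hF).isClosed_preimage]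
  have : F ⁻¹' (T.range : Set E) = {p | p.2 = 0} := by
    ext ⟨a, b⟩
    have h1 : F (a, b) = T a + b := rfl
    simp only [Set.mem_preimage, SetLike.mem_coe, Set.mem_ofPred_eq, h1]
    rw [Submodule.add_mem_iff_right _ (show T a ∈ T.range from ⟨a, rfl⟩)]
    constructor
    · intro hb
      exact Subtype.ext (Submodule.disjoint_def.1 hG.disjoint _ hb b.2)
    · rintro rfl
      exact zero_mem _
  rw [this]
  exact isClosed_singleton.preimage continuous_snd

/-- If `T` has closed range, a functional vanishing on its kernel factors through `T`. -/
theorem exists_comp_eq_of_ker_le [CompleteSpace E] {T : E →L[ℂ] E}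
    (hT : IsClosed (T.range : Set E)) {f : StrongDual ℂ E} (hf : ∀ x, T x = 0 → f x = 0) :
    ∃ g : StrongDual ℂ E, ∀ x, g (T x) = f x := by
  have := hT.completeSpace_coe
  set A : E →L[ℂ] T.range := T.codRestrict T.range fun x => LinearMap.mem_range_self _ x
  have hA : Function.Surjective A := by
    rintro ⟨_, x, rfl⟩
    exact ⟨x, rfl⟩
  -- The section `r` need not be continuous; `f ∘ r` is, because it pulls back to `f` along the
  -- quotient map `A`.
  obtain ⟨r, hr⟩ := (A : E →ₗ[ℂ] T.range).exists_rightInverse_of_surjective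
    (LinearMap.range_eq_top.2 hA)
  have hg : ∀ x, f (r (A x)) = f x := by
    intro x
    rw [← sub_eq_zero, ← map_sub]
    apply hf
    have h1 : A (r (A x)) = A x := LinearMap.congr_fun hr (A x)
    have h2 : T (r (A x)) = T x := congrArg Subtype.val h1
    rw [map_sub, h2, sub_self]
  have hcont : Continuous ((f : E →ₗ[ℂ] ℂ) ∘ₗ r) := by
    rw [(A.isQuotientMap hA).continuous_iff]
    exact f.continuous.congr fun x => (hg x).symm
  obtain ⟨g, hg', -⟩ := exists_extension_norm_eq T.range ⟨(f : E →ₗ[ℂ] ℂ) ∘ₗ r, hcont⟩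
  exact ⟨g, fun x => (hg' (A x)).trans (hg x)⟩

/-- If `f` and `g` form a Jordan chain of length two for the adjoint of `A`, then no
`A + z` is supercyclic. -/
theorem not_isSupercyclic_of_jordan_chain {A : E →L[ℂ] E} {z : ℂ} {f g : StrongDual ℂ E}
    (hf : f ≠ 0) (hfA : ∀ x, f (A x) = 0) (hgA : ∀ x, g (A x) = f x) :
    ¬ IsSupercyclic (A + z • (1 : E →L[ℂ] E)) := by
  rintro ⟨x, hx⟩
  set T := A + z • (1 : E →L[ℂ] E)
  have hT : ∀ y, T y = A y + z • y := fun y => rfl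
  have hfT : ∀ n : ℕ, f ((T ^ n) x) = z ^ n * f x := by
    intro n
    induction n with
    | zero => simp
    | succ n ih =>
      rw [pow_succ', mul_apply_eq_comp, hT, map_add, hfA, map_smul, ih, smul_eq_mul]
      ring
  have hgT : ∀ n : ℕ, g ((T ^ (n + 1)) x) = z ^ (n + 1) * g x + (n + 1) * z ^ n * f x := by
    intro n
    induction n with
    | zero => simp [hT, hgA]; ring
    | succ n ih =>
      rw [pow_succ', mul_apply_eq_comp, hT, map_add, hgA, map_smul, ih, hfT, smul_eq_mul]
      push_cast
      ring
  obtain ⟨y₀, hy₀⟩ : ∃ y, f y = 1 := by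
    obtain ⟨y, hy⟩ := DFunLike.ne_iff.1 hf
    exact ⟨(f y)⁻¹ • y, by simpa using inv_mul_cancel₀ hy⟩
  -- `f` and `g` are independent: `A y₀` has `f = 0` and `g = 1`.
  have hval : ∀ p q : ℂ, ∃ y, f y = p ∧ g y = q := fun p q =>
    ⟨p • y₀ + (q - p * g y₀) • A y₀, by simp [hfA, hy₀], by simp [hgA, hy₀]⟩
  have hmeet : ∀ U : Set (ℂ × ℂ), IsOpen U → U.Nonempty →
      ∃ (c : ℂ) (n : ℕ), (c * f ((T ^ n) x), c * g ((T ^ n) x)) ∈ U := by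
    rintro U hU ⟨⟨p, q⟩, hpq⟩
    obtain ⟨y, hyp, hyq⟩ := hval p q
    obtain ⟨_, hyU, c, n, rfl⟩ := hx.inter_open_nonempty ((fun y => (f y, g y)) ⁻¹' U)
      (hU.preimage (f.continuous.prodMk g.continuous)) ⟨y, by simpa [hyp, hyq] using hpq⟩
    exact ⟨c, n, by simpa using hyU⟩
  have hfx : f x ≠ 0 := by
    intro hfx
    obtain ⟨c, n, h⟩ := hmeet {p | p.1 ≠ 0}
      (isOpen_ne_fun continuous_fst continuous_const) ⟨(1, 0), one_ne_zero⟩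
    exact h (by simp only [hfT, hfx, mul_zero])
  by_cases hz : z = 0
  · obtain ⟨c, n, h1, h2⟩ := hmeet {p | p.1 ≠ 0 ∧ p.2 * f x ≠ p.1 * g x}
      ((isOpen_ne_fun continuous_fst continuous_const).inter
        (isOpen_ne_fun (by fun_prop) (by fun_prop)))
      ⟨(1, (g x + 1) / f x), one_ne_zero, by simp [div_mul_cancel₀ _ hfx]⟩
    rcases n with _ | n
    · apply h2
      simp
      ring
    · exact h1 (by simp only [hfT, hz, zero_pow n.succ_ne_zero, zero_mul, mul_zero])
  -- On the orbit `z (q f x - p g x) = n p f x`, so the tested real part is `n |p f x|² ≥ 0`; the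
  -- witness below gives `-1`.
  · obtain ⟨c, n, h⟩ := hmeet
      {p | (z * (p.2 * f x - p.1 * g x) * (starRingEnd ℂ) (p.1 * f x)).re < 0}
      (isOpen_lt (by fun_prop) continuous_const)
      ⟨((f x)⁻¹, ((f x)⁻¹ * g x - z⁻¹) / f x), by
        simp only [Set.mem_ofPred_eq, div_mul_cancel₀ _ hfx, inv_mul_cancel₀ hfx]
        simp [mul_inv_cancel₀ hz]⟩
    rcases n with _ | n
    · have h1 : z * (c * g ((T ^ 0) x) * f x - c * f ((T ^ 0) x) * g x) = 0 := by
        simp only [pow_zero, one_apply_eq_self]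
        ring
      simp only [Set.mem_ofPred_eq, h1, zero_mul, Complex.zero_re, lt_irrefl] at h
    · have h1 : z * (c * g ((T ^ (n + 1)) x) * f x - c * f ((T ^ (n + 1)) x) * g x) =
          (n + 1 : ℝ) * (c * f ((T ^ (n + 1)) x) * f x) := by
        rw [hfT, hgT]
        push_cast
        ring
      simp only [Set.mem_ofPred_eq, h1, mul_assoc ((n + 1 : ℝ) : ℂ), Complex.mul_conj] at h
      rw [← Complex.ofReal_mul, Complex.ofReal_re] at h
      exact absurd h (not_lt.2 (mul_nonneg (by positivity) (Complex.normSq_nonneg _)))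

/-- A closed subspace containing the range of `A` has codimension at most one as soon as some
`A + z` is supercyclic. -/
theorem exists_sup_span_eq_top {A : E →L[ℂ] E} {z : ℂ}
    (hs : IsSupercyclic (A + z • (1 : E →L[ℂ] E))) (hA : IsClosed (A.range : Set E)) :
    ∃ x : E, A.range ⊔ Submodule.span ℂ {x} = ⊤ := by
  obtain ⟨x, hx⟩ := hs
  refine ⟨x, ?_⟩
  set R := A.range ⊔ Submodule.span ℂ {x}
  have hR : IsClosed (R : Set E) := Submodule.isClosed_sup_finiteDimensional _ _ hA
  have hmem : ∀ n : ℕ, ((A + z • (1 : E →L[ℂ] E)) ^ n) x ∈ R := by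
    intro n
    induction n with
    | zero => exact Submodule.mem_sup_right (Submodule.mem_span_singleton_self x)
    | succ n ih =>
      rw [pow_succ', mul_apply_eq_comp]
      exact R.add_mem (Submodule.mem_sup_left (LinearMap.mem_range_self _ _)) (R.smul_mem z ih)
  rw [eq_top_iff]
  intro y _
  refine hR.closure_subset_iff.2 ?_ (hx y)
  rintro _ ⟨c, n, rfl⟩
  exact R.smul_mem c (hmem n)

/-- If `A` is lower semi-Fredholm and `A + z` is supercyclic, then the range of `A` is
complemented by a subspace of the kernel of dimension at most one. -/
theorem IsLowerSemiFredholm.exists_isCompl_span [CompleteSpace E] {A : E →L[ℂ] E} {z : ℂ}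
    (hA : IsLowerSemiFredholm A) (hs : IsSupercyclic (A + z • (1 : E →L[ℂ] E))) :
    ∃ w : E, A w = 0 ∧ IsCompl A.range (Submodule.span ℂ {w}) := by
  have hcl := hA.isClosed_range
  obtain ⟨x, hx⟩ := exists_sup_span_eq_top hs hcl
  by_cases hxR : x ∈ A.range
  · refine ⟨0, map_zero A, ?_⟩
    have h1 : A.range = ⊤ := by
      rwa [sup_eq_left.2 ((Submodule.span_singleton_le_iff_mem _ _).2 hxR)] at hx
    rw [h1]
    simpa using isCompl_top_bot
  obtain ⟨w, hw, hwR⟩ : ∃ w, A w = 0 ∧ w ∉ A.range := by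
    -- A functional annihilating the range now vanishes on the kernel, hence starts a Jordan chain
    -- of the adjoint.
    by_contra! hker
    have hq : A.range.mkQ x ≠ 0 := by
      rwa [Ne, Submodule.mkQ_apply, Submodule.Quotient.mk_eq_zero]
    have : IsClosed (A.range : Set E) := hcl
    obtain ⟨φ, hφ⟩ := SeparatingDual.exists_ne_zero (R := ℂ) hq
    set f : StrongDual ℂ E := φ ∘L A.range.mkQL
    have hfR : ∀ y ∈ A.range, f y = 0 := fun y hy => by
      have : A.range.mkQ y = 0 := (Submodule.Quotient.mk_eq_zero _).2 hy
      change φ (A.range.mkQ y) = 0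
      rw [this, map_zero]
    obtain ⟨g, hg⟩ := exists_comp_eq_of_ker_le hcl (f := f) fun y hy => hfR y (hker y hy)
    refine not_isSupercyclic_of_jordan_chain (f := f) (g := g) (fun h => hφ ?_)
      (fun y => hfR _ (LinearMap.mem_range_self _ y)) hg hs
    exact DFunLike.congr_fun h x
  refine ⟨w, hw, ?_, ?_⟩
  · rw [Submodule.disjoint_def]
    intro y hy hyw
    obtain ⟨c, rfl⟩ := Submodule.mem_span_singleton.1 hyw
    by_contra h0
    have hc : c ≠ 0 := fun h => h0 (by rw [h, zero_smul])
    exact hwR ((Submodule.smul_mem_iff _ hc).1 hy)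
  -- Exchange argument: `w` has a nonzero `x`-component modulo the range, so it can replace `x`.
  · rw [codisjoint_iff, eq_top_iff, ← hx]
    refine sup_le le_sup_left ((Submodule.span_singleton_le_iff_mem _ _).2 ?_)
    obtain ⟨r, hr, s, hs', hrs⟩ := Submodule.mem_sup.1
      (hx ▸ Submodule.mem_top : w ∈ A.range ⊔ Submodule.span ℂ {x})
    obtain ⟨c, rfl⟩ := Submodule.mem_span_singleton.1 hs'
    have hc : c ≠ 0 := by
      rintro rfl
      apply hwR
      rw [← hrs, zero_smul, add_zero]
      exact hr
    have hxw : x = c⁻¹ • (w - r) := by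
      rw [← hrs, add_sub_cancel_left, smul_smul, inv_mul_cancel₀ hc, one_smul]
    rw [hxw]
    exact Submodule.smul_mem _ _ (sub_mem
      (Submodule.mem_sup_right (Submodule.mem_span_singleton_self w)) (Submodule.mem_sup_left hr))

/-- Supercyclicity passes to the summands of a reducing pair. -/
theorem IsReducingPair.isSupercyclic_restrict [CompleteSpace E] {A : E →L[ℂ] E} {z : ℂ}
    {M N : Submodule ℂ E} (h : IsReducingPair A M N)
    (hs : IsSupercyclic (A + z • (1 : E →L[ℂ] E))) :
    IsSupercyclic (A.restrict h.invariant_left + z • (1 : M →L[ℂ] M)) := by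
  obtain ⟨x, hx⟩ := hs
  set P := M.projectionOntoL N h.isTopCompl with hP
  have hpow : ∀ n : ℕ, P (((A + z • (1 : E →L[ℂ] E)) ^ n) x) =
      ((A.restrict h.invariant_left + z • (1 : M →L[ℂ] M)) ^ n) (P x) := by
    intro n
    induction n with
    | zero => simp
    | succ n ih =>
      rw [pow_succ', pow_succ', mul_apply_eq_comp, mul_apply_eq_comp, ← ih]
      simp only [add_apply, smul_apply, one_apply_eq_self, map_add, map_smul]
      rw [h.projectionOntoL_apply]
  refine ⟨P x, ((Submodule.projectionOntoL_surjective h.isTopCompl).denseRange.dense_image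
    P.continuous hx).mono ?_⟩
  rintro _ ⟨_, ⟨c, n, rfl⟩, rfl⟩
  exact ⟨c, n, by rw [map_smul, hpow]⟩

/-- For `A` a shift of a supercyclic operator, a pseudo lower semi B-Fredholm decomposition can be
corrected to a right generalized Drazin decomposition by moving an eigenvector. -/
theorem IsPseudoLowerSemiBFredholm.isRightGeneralizedDrazin [CompleteSpace E] {A : E →L[ℂ] E}
    {z : ℂ} (hA : IsPseudoLowerSemiBFredholm A)
    (hs : IsSupercyclic (A + z • (1 : E →L[ℂ] E))) : IsRightGeneralizedDrazin A := by
  obtain ⟨M, N, h, hM, hN⟩ := hA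
  have hN' := (isQuasinilpotent_restrict_iff h.isClosed_right _).1 hN
  have := h.isClosed_left.completeSpace_coe
  set B := A.restrict h.invariant_left
  obtain ⟨w, hw, hcompl⟩ := hM.exists_isCompl_span (h.isSupercyclic_restrict hs)
  have hAw : A w = 0 := congrArg Subtype.val hw
  have hsup : B.range.map M.subtype ⊔ Submodule.span ℂ {(w : E)} = M := by
    have h1 := congrArg (Submodule.map M.subtype) hcompl.sup_eq_top
    rwa [Submodule.map_sup, Submodule.map_span, Set.image_singleton, Submodule.map_top,
      Submodule.range_subtype] at h1
  have hinter : ∀ y ∈ B.range.map M.subtype, y ∈ Submodule.span ℂ {(w : E)} → y = 0 := by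
    rintro _ ⟨r, hr, rfl⟩ hrw
    obtain ⟨c, hc⟩ := Submodule.mem_span_singleton.1 hrw
    have : r = c • w := Subtype.ext hc.symm
    have : r = 0 := Submodule.disjoint_def.1 hcompl.disjoint r hr
      (this ▸ Submodule.smul_mem _ c (Submodule.mem_span_singleton_self w))
    rw [this, map_zero]
  have hRM : B.range.map M.subtype ≤ M := Submodule.map_subtype_le _ _
  refine isRightGeneralizedDrazin_iff.2
    ⟨B.range.map M.subtype, N ⊔ Submodule.span ℂ {(w : E)}, ⟨⟨?_, ?_⟩, ?_, ?_, ?_, ?_⟩, ?_, ?_⟩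
  · rw [Submodule.disjoint_def]
    intro y hy hyN
    obtain ⟨n, hn, s, hs', rfl⟩ := Submodule.mem_sup.1 hyN
    have hsM : s ∈ M := (Submodule.span_singleton_le_iff_mem _ _).2 w.2 hs'
    have hn0 : n = 0 := Submodule.disjoint_def.1 h.isCompl.disjoint n
      ((Submodule.add_mem_iff_left _ hsM).1 (hRM hy)) hn
    subst hn0
    rw [zero_add] at hy ⊢
    exact hinter s hy hs'
  · rw [codisjoint_iff, sup_comm N, ← sup_assoc, hsup, h.isCompl.sup_eq_top]
  · exact h.isClosed_left.isClosedEmbedding_subtypeVal.isClosedMap _ hM.isClosed_range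
  · exact Submodule.isClosed_sup_finiteDimensional _ _ h.isClosed_right
  · rintro _ ⟨r, -, rfl⟩
    exact ⟨B r, LinearMap.mem_range_self _ r, rfl⟩
  · intro y hy
    obtain ⟨n, hn, s, hs', rfl⟩ := Submodule.mem_sup.1 hy
    obtain ⟨c, rfl⟩ := Submodule.mem_span_singleton.1 hs'
    rw [map_add, map_smul, hAw, smul_zero, add_zero]
    exact Submodule.mem_sup_left (h.invariant_right n hn)
  -- Surjectivity on `ran B`: dropping the `w`-component of a preimage does not change its image.
  · rintro _ ⟨_, ⟨y, rfl⟩, rfl⟩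
    obtain ⟨r, hr, s, hs', rfl⟩ := Submodule.mem_sup.1
      (hcompl.sup_eq_top ▸ Submodule.mem_top : y ∈ B.range ⊔ Submodule.span ℂ {w})
    obtain ⟨c, rfl⟩ := Submodule.mem_span_singleton.1 hs'
    refine ⟨r, ⟨r, hr, rfl⟩, ?_⟩
    change A r = A (r + c • w)
    rw [map_add, map_smul, hAw, smul_zero, add_zero]
  · intro y hy
    obtain ⟨n, hn, s, hs', rfl⟩ := Submodule.mem_sup.1 hy
    obtain ⟨c, rfl⟩ := Submodule.mem_span_singleton.1 hs'
    -- Adding a kernel vector alters only the zeroth iterate.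
    refine (tendsto_congr' ?_).1 (hN' hn)
    filter_upwards [eventually_ne_atTop 0] with k hk
    obtain ⟨k, rfl⟩ := Nat.exists_eq_succ_of_ne_zero hk
    have hk0 : (A ^ (k + 1)) (w : E) = 0 := by
      rw [pow_succ, mul_apply_eq_comp, hAw, map_zero]
    rw [map_add, map_smul, hk0, smul_zero, add_zero]

end

end SupercyclicOp

theorem mainTheorem12 {X : Type*} [NormedAddCommGroup X] [NormedSpace ℂ X] [CompleteSpace X]
    (T : X →L[ℂ] X) (hT : SupercyclicOp.IsSupercyclic T) :
    SupercyclicOp.rightGeneralizedDrazinSpectrum T =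
      SupercyclicOp.pseudoLowerSemiBFredholmSpectrum T := by
  ext z
  refine not_congr ⟨fun h => h.isPseudoLowerSemiBFredholm,
    fun h => h.isRightGeneralizedDrazin (z := z) ?_⟩
  rwa [sub_add_cancel]
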